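/- Let $M$ be a smooth manifold of dimension $n>2$, let $g$ be a smooth Lorentzian metric on $M$ of signature $(+,-,\dots,-)$, and let $m,\xi\in\mathbb R$ with $0\le\xi\le\xi_c:=\frac{n-2}{4(n-1)}$. The sign conventions are the $[-,-,-]$ conventions of Misner, Thorne and Wheeler: $R^{k}{}_{lij}=-(\partial_i\Gamma^k_{jl}-\partial_j\Gamma^k_{il}+\Gamma^k_{ia}\Gamma^a_{jl}-\Gamma^k_{ja}\Gamma^a_{il})$, $R_{ij}=R^{a}{}_{iaj}$, $R=g^{ij}R_{ij}$, $G_{ij}=R_{ij}-\frac12Rg_{ij}$, and $\Box_g=g^{ij}\nabla_i\nabla_j$. Let the smooth function $\phi:M\to\mathbb R$ be such that $(M,g,\phi)$ solves the Einstein–Klein–Gordon system with mass $m$ and coupling constant $\xi$ (in units with $G=c=1$), that is, $$(\Box_g+m^2+\xi R)\phi=0,\qquad G_{\mu\nu}=-8\pi T_{\mu\nu},$$ where $$T_{\mu\nu}=(\nabla_\mu\phi)(\nabla_\nu\phi)+\tfrac12g_{\mu\nu}\bigl(m^2\phi^2-(\nabla\phi)^2\bigr)+\xi\,(g_{\mu\nu}\Box_g-\nabla_\mu\nabla_\nu-G_{\mu\nu})\phi^2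 .$$ Suppose that $|\phi|\le(8\pi\xi)^{-1/2}$ on $M$, i.e. $8\pi\xi\phi^2\le1$ (no condition if $\xi=0$). Let $\gamma:I\to M$ be a timelike geodesic on an open interval $I\subseteq\mathbb R$, parametrized by proper time $\tau$, so $g(\dot\gamma,\dot\gamma)=1$. Let $f:\mathbb R\to\mathbb R$ be a $C^2$ function with compact support contained in $I$, such that $8\pi\xi\,\phi(\gamma(\tau))^2<1$ for all $\tau\in\operatorname{supp}f$ (so that the right side below is defined). Then both integrands below are integrable on $I$ and $$\int_I R_{\mu\nu}\dot\gamma^\mu\dot\gamma^\nu f^2(\tau)\,d\tau\ \le\ \int_I\left\{\frac{1-2\xi}{n-2}\,\frac{m^2f^2(\tau)}{1-8\pi\xi\phi^2}+2\xi\left(\frac{d}{d\tau}\frac{f(\tau)}{\sqrt{1-8\pi\xi\phi^2}}\right)^2\right\}8\pi\phi^2\,d\tau,$$ where $\phi$ is evaluated at $\gamma(\tau)$. -/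

import Mathlib

open scoped Manifold ContDiff Bundle

noncomputable section

/-! ### Tensor calculus in a coordinate domain of `ℝⁿ` -/

/-- The partial derivative `∂ᵢ F` at `y`. -/
def coordPartial {n : ℕ} (i : Fin n) (F : EuclideanSpace ℝ (Fin n) → ℝ)
    (y : EuclideanSpace ℝ (Fin n)) : ℝ :=
  fderiv ℝ F y (EuclideanSpace.single i (1 : ℝ))

/-- The Christoffel symbol `Γᵏᵢⱼ = ½ gᵏˡ (∂ᵢ gⱼₗ + ∂ⱼ gᵢₗ - ∂ₗ gᵢⱼ)` of the metric with coordinate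
matrix `G`. -/
def coordChristoffel {n : ℕ} (G : EuclideanSpace ℝ (Fin n) → Matrix (Fin n) (Fin n) ℝ)
    (k i j : Fin n) (y : EuclideanSpace ℝ (Fin n)) : ℝ :=
  (1 / 2) * ∑ l, (G y)⁻¹ k l *
    (coordPartial i (fun z => G z j l) y + coordPartial j (fun z => G z i l) y
      - coordPartial l (fun z => G z i j) y)

/-- The Riemann tensor `Rᵏₗᵢⱼ`, with the sign convention of the `[-,-,-]` class of Misner, Thorne
and Wheeler: `Rᵏₗᵢⱼ = -(∂ᵢ Γᵏⱼₗ - ∂ⱼ Γᵏᵢₗ + Γᵏᵢₐ Γᵃⱼₗ - Γᵏⱼₐ Γᵃᵢₗ)`. -/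
def coordRiemann {n : ℕ} (G : EuclideanSpace ℝ (Fin n) → Matrix (Fin n) (Fin n) ℝ)
    (k l i j : Fin n) (y : EuclideanSpace ℝ (Fin n)) : ℝ :=
  -(coordPartial i (coordChristoffel G k j l) y - coordPartial j (coordChristoffel G k i l) y
    + ∑ a, (coordChristoffel G k i a y * coordChristoffel G a j l y
      - coordChristoffel G k j a y * coordChristoffel G a i l y))

/-- The Ricci tensor `Rᵢⱼ = Rᵃᵢₐⱼ`. -/
def coordRicci {n : ℕ} (G : EuclideanSpace ℝ (Fin n) → Matrix (Fin n) (Fin n) ℝ)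
    (i j : Fin n) (y : EuclideanSpace ℝ (Fin n)) : ℝ :=
  ∑ a, coordRiemann G a i a j y

/-- The second covariant derivative `∇ᵢ∇ⱼ u = ∂ᵢ∂ⱼ u - Γᵏᵢⱼ ∂ₖ u` of a function. -/
def coordHessian {n : ℕ} (G : EuclideanSpace ℝ (Fin n) → Matrix (Fin n) (Fin n) ℝ)
    (u : EuclideanSpace ℝ (Fin n) → ℝ) (i j : Fin n) (y : EuclideanSpace ℝ (Fin n)) : ℝ :=
  coordPartial i (coordPartial j u) y - ∑ k, coordChristoffel G k i j y * coordPartial k u y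

/-! ### Lorentzian metrics -/

/-- A smooth Lorentzian metric of signature `(+,-,…,-)` on an `n`-dimensional manifold. -/
structure LorentzMetric (n : ℕ) (M : Type*) [TopologicalSpace M]
    [ChartedSpace (EuclideanSpace ℝ (Fin n)) M] [IsManifold (𝓡 n) ∞ M] where
  /-- The bilinear form on each tangent space. -/
  val (x : M) : TangentSpace (𝓡 n) x →L[ℝ] TangentSpace (𝓡 n) x →L[ℝ] ℝ
  symm (x : M) (v w : TangentSpace (𝓡 n) x) : val x v w = val x w v
  /-- There is a positive vector on whose orthogonal complement the form is negative definite. -/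
  signature (x : M) : ∃ v : TangentSpace (𝓡 n) x, 0 < val x v v ∧
    ∀ w : TangentSpace (𝓡 n) x, val x v w = 0 → w ≠ 0 → val x w w < 0
  contMDiff : ContMDiff (𝓡 n)
    ((𝓡 n).prod 𝓘(ℝ, EuclideanSpace ℝ (Fin n) →L[ℝ] EuclideanSpace ℝ (Fin n) →L[ℝ] ℝ)) ∞
    (fun x => Bundle.TotalSpace.mk'
      (EuclideanSpace ℝ (Fin n) →L[ℝ] EuclideanSpace ℝ (Fin n) →L[ℝ] ℝ) x (val x))

namespace LorentzMetric

variable {n : ℕ} {M : Type*} [TopologicalSpace M]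
  [ChartedSpace (EuclideanSpace ℝ (Fin n)) M] [IsManifold (𝓡 n) ∞ M]

/-- The matrix `gᵢⱼ = g(∂ᵢ, ∂ⱼ)` of the metric in the preferred chart at `p`, as a function of the
coordinates `y`; the coordinate vector field `∂ᵢ` is the image of the `i`-th standard basis vector
under the differential of the inverse chart. -/
def coeff (g : LorentzMetric n M) (p : M) (y : EuclideanSpace ℝ (Fin n)) :
    Matrix (Fin n) (Fin n) ℝ :=
  Matrix.of fun i j => g.val ((extChartAt (𝓡 n) p).symm y)
    (mfderiv (𝓡 n) (𝓡 n) (extChartAt (𝓡 n) p).symm y (EuclideanSpace.single i (1 : ℝ)))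
    (mfderiv (𝓡 n) (𝓡 n) (extChartAt (𝓡 n) p).symm y (EuclideanSpace.single j (1 : ℝ)))

/- Below, the components of a tensor at `p` are its components at `p` in the preferred chart
at `p`. -/

/-- The components `gᵢⱼ` at `p`. -/
def lower (g : LorentzMetric n M) (p : M) (i j : Fin n) : ℝ :=
  g.coeff p (extChartAt (𝓡 n) p p) i j

/-- The components `gⁱʲ` of the inverse metric at `p`. -/
def upper (g : LorentzMetric n M) (p : M) (i j : Fin n) : ℝ :=
  (g.coeff p (extChartAt (𝓡 n) p p))⁻¹ i j

/-- The Christoffel symbols `Γᵏᵢⱼ` at `p`. -/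
def christoffel (g : LorentzMetric n M) (p : M) (k i j : Fin n) : ℝ :=
  coordChristoffel (g.coeff p) k i j (extChartAt (𝓡 n) p p)

/-- The components `Rᵢⱼ` of the Ricci tensor at `p`. -/
def ricci (g : LorentzMetric n M) (p : M) (i j : Fin n) : ℝ :=
  coordRicci (g.coeff p) i j (extChartAt (𝓡 n) p p)

/-- The Ricci scalar `R = gⁱʲ Rᵢⱼ`. -/
def ricciScalar (g : LorentzMetric n M) (p : M) : ℝ :=
  ∑ i, ∑ j, g.upper p i j * g.ricci p i j

/-- The Einstein tensor `Gᵢⱼ = Rᵢⱼ - ½ R gᵢⱼ`. -/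
def einstein (g : LorentzMetric n M) (p : M) (i j : Fin n) : ℝ :=
  g.ricci p i j - (1 / 2) * g.ricciScalar p * g.lower p i j

end LorentzMetric

/-- The components `∇ᵢ u` of the differential of a function at `p`. -/
def scalarGrad {n : ℕ} {M : Type*} [TopologicalSpace M]
    [ChartedSpace (EuclideanSpace ℝ (Fin n)) M] (u : M → ℝ) (p : M) (i : Fin n) : ℝ :=
  coordPartial i (fun y => u ((extChartAt (𝓡 n) p).symm y)) (extChartAt (𝓡 n) p p)

namespace LorentzMetric

variable {n : ℕ} {M : Type*} [TopologicalSpace M]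
  [ChartedSpace (EuclideanSpace ℝ (Fin n)) M] [IsManifold (𝓡 n) ∞ M]

/-- `(∇u)² = gⁱʲ ∇ᵢu ∇ⱼu`. -/
def gradSq (g : LorentzMetric n M) (u : M → ℝ) (p : M) : ℝ :=
  ∑ i, ∑ j, g.upper p i j * scalarGrad u p i * scalarGrad u p j

/-- The components `∇ᵢ∇ⱼ u` at `p`. -/
def hessian (g : LorentzMetric n M) (u : M → ℝ) (p : M) (i j : Fin n) : ℝ :=
  coordHessian (g.coeff p) (fun y => u ((extChartAt (𝓡 n) p).symm y)) i j (extChartAt (𝓡 n) p p)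

/-- The d'Alembertian `□u = gⁱʲ ∇ᵢ∇ⱼ u`. -/
def dAlembert (g : LorentzMetric n M) (u : M → ℝ) (p : M) : ℝ :=
  ∑ i, ∑ j, g.upper p i j * g.hessian u p i j

/-- The stress-energy tensor of the scalar field `φ` of mass `m` and coupling `ξ`:
`Tᵢⱼ = ∇ᵢφ ∇ⱼφ + ½ gᵢⱼ (m²φ² - (∇φ)²) + ξ (gᵢⱼ □ - ∇ᵢ∇ⱼ - Gᵢⱼ) φ²`. -/
def stressEnergy (g : LorentzMetric n M) (m ξ : ℝ) (φ : M → ℝ) (p : M) (i j : Fin n) : ℝ :=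
  scalarGrad φ p i * scalarGrad φ p j
    + (1 / 2) * g.lower p i j * (m ^ 2 * φ p ^ 2 - g.gradSq φ p)
    + ξ * (g.lower p i j * g.dAlembert (fun x => φ x ^ 2) p
      - g.hessian (fun x => φ x ^ 2) p i j - g.einstein p i j * φ p ^ 2)

/-- `(M, g, φ)` is a (smooth) solution of the Einstein–Klein–Gordon system with mass `m` and
coupling constant `ξ`, in units with `G = c = 1`. -/
structure IsEinsteinKleinGordon (g : LorentzMetric n M) (m ξ : ℝ) (φ : M → ℝ) : Prop where
  contMDiff : ContMDiff (𝓡 n) 𝓘(ℝ, ℝ) ∞ φ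
  /-- The field equation `(□ + m² + ξR) φ = 0`. -/
  kleinGordon (p : M) : g.dAlembert φ p + m ^ 2 * φ p + ξ * g.ricciScalar p * φ p = 0
  /-- The Einstein equation `Gᵢⱼ = -8π Tᵢⱼ`. -/
  einsteinEq (p : M) (i j : Fin n) :
    g.einstein p i j = -(8 * Real.pi * g.stressEnergy m ξ φ p i j)

end LorentzMetric

/-! ### Timelike geodesics -/

/-- The `i`-th coordinate of `γ s` in the preferred chart at the point `γ τ`. -/
def curveCoord {n : ℕ} {M : Type*} [TopologicalSpace M]
    [ChartedSpace (EuclideanSpace ℝ (Fin n)) M] (γ : ℝ → M) (τ : ℝ) (i : Fin n) (s : ℝ) : ℝ :=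
  extChartAt (𝓡 n) (γ τ) (γ s) i

/-- The components `γ̇ⁱ(τ)` of the velocity, in the preferred chart at `γ τ`. -/
def curveVelocity {n : ℕ} {M : Type*} [TopologicalSpace M]
    [ChartedSpace (EuclideanSpace ℝ (Fin n)) M] (γ : ℝ → M) (τ : ℝ) (i : Fin n) : ℝ :=
  deriv (curveCoord γ τ i) τ

namespace LorentzMetric

variable {n : ℕ} {M : Type*} [TopologicalSpace M]
  [ChartedSpace (EuclideanSpace ℝ (Fin n)) M] [IsManifold (𝓡 n) ∞ M]

/-- On the open set `I` of parameters, `γ` is a timelike geodesic parametrized by proper time. -/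
structure IsProperTimeGeodesicOn (g : LorentzMetric n M) (γ : ℝ → M) (I : Set ℝ) : Prop where
  contMDiffOn : ContMDiffOn 𝓘(ℝ, ℝ) (𝓡 n) 2 γ I
  /-- `g(γ̇, γ̇) = 1`. -/
  unit (τ : ℝ) (hτ : τ ∈ I) :
    ∑ i, ∑ j, g.lower (γ τ) i j * curveVelocity γ τ i * curveVelocity γ τ j = 1
  /-- The geodesic equation `γ̈ᵏ + Γᵏᵢⱼ γ̇ⁱ γ̇ʲ = 0`. -/
  geodesic (τ : ℝ) (hτ : τ ∈ I) (k : Fin n) :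
    deriv (deriv (curveCoord γ τ k)) τ
      + ∑ i, ∑ j, g.christoffel (γ τ) k i j * curveVelocity γ τ i * curveVelocity γ τ j = 0

/-- `Rᵢⱼ γ̇ⁱ γ̇ʲ` at parameter `τ`. -/
def ricciAlong (g : LorentzMetric n M) (γ : ℝ → M) (τ : ℝ) : ℝ :=
  ∑ i, ∑ j, g.ricci (γ τ) i j * curveVelocity γ τ i * curveVelocity γ τ j

end LorentzMetric

end

/-!
Write `w = 1 - 8πξφ²` and `h = f / √w`, and let primes denote derivatives along the geodesic `γ`, so
that `φ' = ∇φ · γ̇` and, by the geodesic equation, `(φ²)'' = ∇ᵢ∇ⱼ(φ²) γ̇ⁱ γ̇ʲ`. Contracting the Einstein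
equation with `γ̇` and with the inverse metric gives
`w Rᵢⱼγ̇ⁱγ̇ʲ = 8π (-φ'² + ξ (φ²)'' + (m²φ² + ξ □φ²)/(n - 2))`.
By the field equation `□φ² = 2(∇φ)² - 2m²φ² - 2ξRφ²`, and the trace of the Einstein equation
determines `R`; hence `□φ² = ((n - 2)(∇φ)² - m²φ² (n - 2 + 16πξφ²)) / D`, where the denominator
`D` (`traceDenominator`) is positive and at least `2(n - 1)ξ` because `ξ ≤ ξ_c` and `8πξφ² ≤ 1`. This is
`ricci_eq_of_field_equations`.

Since `γ̇` is a unit timelike vector, the reverse Cauchy–Schwarz inequality gives `(∇φ)² ≤ φ'²`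
(`LorentzMetric.gradSq_le_sq`). After multiplication by `f²`, the term `ξ h² (φ²)''` is the derivative
of `ξ h² (φ²)'`, whose integral vanishes, minus `4ξ h h' φ φ'`. What is left exceeds the desired bound
by at most `-(1 - 2ξ - ξ/D) h² φ'² - 2ξ (h φ' + h' φ)²` times `8π`, which is nonpositive
(`ricci_mul_sq_le`).

Tensor components at a point are taken in the preferred chart at that point, so their continuity along
`γ` is not immediate. By the formula above, integrability of the Ricci term only needs the continuity
of `(∇φ)²`, which holds because the contraction of a covector with the inverse Gram matrix does not
depend on the basis (`inverse_gram_contraction_eq`).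
-/

noncomputable section

/-! ### Lorentzian bilinear forms -/

section LorentzForm

variable {V : Type*} [AddCommGroup V] [Module ℝ V] [TopologicalSpace V]

theorem lorentzForm_nondegenerate {B : V →L[ℝ] V →L[ℝ] ℝ}
    (he : ∃ v, 0 < B v v ∧ ∀ w, B v w = 0 → w ≠ 0 → B w w < 0)
    (hs : ∀ v w, B v w = B w v) {x : V} (hx : ∀ w, B x w = 0) : x = 0 := by
  obtain ⟨e, -, he⟩ := he
  by_contra h
  have := he x (by rw [hs, hx]) h
  rw [hx] at this
  exact lt_irrefl _ this

/-- The form is negative semidefinite on the orthogonal complement of every timelike vector, not only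
of the one that the signature condition provides. -/
theorem lorentzForm_nonpos_of_orthogonal {B : V →L[ℝ] V →L[ℝ] ℝ}
    (he : ∃ v, 0 < B v v ∧ ∀ w, B v w = 0 → w ≠ 0 → B w w < 0)
    (hs : ∀ v w, B v w = B w v) {v w : V} (hv : B v v = 1) (hvw : B v w = 0) : B w w ≤ 0 := by
  obtain ⟨e, -, he⟩ := he
  by_contra! hw
  -- the plane spanned by `v` and `w` meets the orthogonal complement of `e` in this vector
  have h1 : B e (B e w • v - B e v • w) = 0 := by
    simp only [map_sub, map_smul, smul_eq_mul]; ring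
  have h2 : B (B e w • v - B e v • w) (B e w • v - B e v • w)
      = (B e w) ^ 2 + (B e v) ^ 2 * B w w := by
    simp only [map_sub, map_smul, smul_eq_mul, sub_apply,
      smul_apply, hv, hvw, hs w v]
    ring
  by_cases hz : B e w • v - B e v • w = 0
  · rw [hz, map_zero] at h2
    have hev : B e v = 0 := by
      have : (B e v) ^ 2 * B w w = 0 := by
        have := mul_nonneg (sq_nonneg (B e v)) hw.le
        nlinarith [sq_nonneg (B e w)]
      rcases mul_eq_zero.1 this with h | h
      · exact pow_eq_zero_iff two_ne_zero |>.1 h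
      · exact absurd h hw.ne'
    have hv0 : v ≠ 0 := by rintro rfl; simp at hv
    have := he v hev hv0
    linarith
  · have := he _ h1 hz
    rw [h2] at this
    nlinarith [sq_nonneg (B e w), mul_nonneg (sq_nonneg (B e v)) hw.le]

/-- Reverse Cauchy–Schwarz inequality, for a unit timelike vector `v`. -/
theorem lorentzForm_self_le_sq {B : V →L[ℝ] V →L[ℝ] ℝ}
    (he : ∃ v, 0 < B v v ∧ ∀ w, B v w = 0 → w ≠ 0 → B w w < 0)
    (hs : ∀ v w, B v w = B w v) {v : V} (hv : B v v = 1) (x : V) : B x x ≤ (B x v) ^ 2 := by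
  have h := lorentzForm_nonpos_of_orthogonal he hs (v := v) (w := x - B x v • v) hv
    (by simp [hv, hs v x])
  simp only [map_sub, map_smul, smul_eq_mul, sub_apply,
    smul_apply, hv, hs v x] at h
  linarith

variable {ι : Type*} [Fintype ι] [DecidableEq ι]

theorem isUnit_det_gram {B : V →L[ℝ] V →L[ℝ] ℝ}
    (he : ∃ v, 0 < B v v ∧ ∀ w, B v w = 0 → w ≠ 0 → B w w < 0)
    (hs : ∀ v w, B v w = B w v) (b : Module.Basis ι ℝ V) :
    IsUnit (Matrix.of fun i j => B (b i) (b j)).det := by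
  rw [isUnit_iff_ne_zero]
  intro h0
  obtain ⟨c, hc, hc0⟩ := Matrix.exists_vecMul_eq_zero_iff.2 h0
  apply hc
  have : ∑ i, c i • b i = 0 := by
    apply lorentzForm_nondegenerate he hs
    suffices h : (B (∑ i, c i • b i) : V →ₗ[ℝ] ℝ) = 0 from fun w => LinearMap.congr_fun h w
    refine b.ext fun j => ?_
    have := congrFun hc0 j
    simpa [Matrix.vecMul, dotProduct] using this
  ext i
  exact Fintype.linearIndependent_iff.1 b.linearIndependent c this i

/-- The vector dual to the covector `α`, whose value under `α` is the contraction of `α` with itself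
by the inverse Gram matrix in any basis. -/
theorem exists_metric_dual_vector {B : V →L[ℝ] V →L[ℝ] ℝ}
    (he : ∃ v, 0 < B v v ∧ ∀ w, B v w = 0 → w ≠ 0 → B w w < 0)
    (hs : ∀ v w, B v w = B w v) (b : Module.Basis ι ℝ V) (α : V →ₗ[ℝ] ℝ) :
    ∃ x, (∀ w, B x w = α w) ∧
      ∑ i, ∑ j, (Matrix.of fun i j => B (b i) (b j))⁻¹ i j * α (b i) * α (b j) = α x := by
  set G : Matrix ι ι ℝ := Matrix.of fun i j => B (b i) (b j) with hG
  have hdet : IsUnit G.det := isUnit_det_gram he hs b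
  have hinv : G * G⁻¹ = 1 := Matrix.mul_nonsing_inv G hdet
  refine ⟨∑ i, (∑ j, G⁻¹ i j * α (b j)) • b i, ?_, ?_⟩
  · suffices h : (B (∑ i, (∑ j, G⁻¹ i j * α (b j)) • b i) : V →ₗ[ℝ] ℝ) = α from
      fun w => LinearMap.congr_fun h w
    refine b.ext fun k => ?_
    have h1 : ∀ j, ∑ i, G⁻¹ i j * B (b i) (b k) = if k = j then 1 else 0 := by
      intro j
      rw [← Matrix.one_apply, ← hinv, Matrix.mul_apply]
      refine Finset.sum_congr rfl fun i _ => ?_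
      rw [hs, mul_comm]; rfl
    calc _ = ∑ i, ∑ j, G⁻¹ i j * α (b j) * B (b i) (b k) := by
            simp [Finset.sum_mul]
      _ = ∑ j, α (b j) * ∑ i, G⁻¹ i j * B (b i) (b k) := by
            rw [Finset.sum_comm]
            refine Finset.sum_congr rfl fun j _ => ?_
            rw [Finset.mul_sum]
            exact Finset.sum_congr rfl fun i _ => by ring
      _ = α (b k) := by simp [h1]
  · rw [map_sum]
    refine Finset.sum_congr rfl fun i _ => ?_
    rw [map_smul, smul_eq_mul, Finset.sum_mul]
    exact Finset.sum_congr rfl fun j _ => by ring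

/-- The square of a covector does not depend on the basis in which it is computed. -/
theorem inverse_gram_contraction_eq {B : V →L[ℝ] V →L[ℝ] ℝ}
    (he : ∃ v, 0 < B v v ∧ ∀ w, B v w = 0 → w ≠ 0 → B w w < 0)
    (hs : ∀ v w, B v w = B w v) (b b' : Module.Basis ι ℝ V) (α : V →ₗ[ℝ] ℝ) :
    ∑ i, ∑ j, (Matrix.of fun i j => B (b i) (b j))⁻¹ i j * α (b i) * α (b j)
      = ∑ i, ∑ j, (Matrix.of fun i j => B (b' i) (b' j))⁻¹ i j * α (b' i) * α (b' j) := by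
  obtain ⟨x, hx, h⟩ := exists_metric_dual_vector he hs b α
  obtain ⟨x', hx', h'⟩ := exists_metric_dual_vector he hs b' α
  have : x - x' = 0 := lorentzForm_nondegenerate he hs fun w => by
    simp [hx, hx']
  rw [h, h', sub_eq_zero.1 this]

theorem inverse_gram_contraction_le_sq {B : V →L[ℝ] V →L[ℝ] ℝ}
    (he : ∃ v, 0 < B v v ∧ ∀ w, B v w = 0 → w ≠ 0 → B w w < 0)
    (hs : ∀ v w, B v w = B w v) (b : Module.Basis ι ℝ V) (α : V →ₗ[ℝ] ℝ)
    {v : V} (hv : B v v = 1) :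
    ∑ i, ∑ j, (Matrix.of fun i j => B (b i) (b j))⁻¹ i j * α (b i) * α (b j) ≤ α v ^ 2 := by
  obtain ⟨x, hx, h⟩ := exists_metric_dual_vector he hs b α
  rw [h, ← hx x, ← hx v]
  exact lorentzForm_self_le_sq he hs hv x

end LorentzForm

/-! ### The metric and the gradient in a chart -/

section Chart

variable {n : ℕ} {M : Type*} [TopologicalSpace M]
  [ChartedSpace (EuclideanSpace ℝ (Fin n)) M] [IsManifold (𝓡 n) ∞ M]

/-- The coordinate vector fields of a chart form a basis of each tangent space. -/
theorem exists_coordinate_basis (p : M) {y : EuclideanSpace ℝ (Fin n)}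
    (hy : y ∈ (extChartAt (𝓡 n) p).target) :
    ∃ b : Module.Basis (Fin n) ℝ (TangentSpace (𝓡 n) ((extChartAt (𝓡 n) p).symm y)),
      ∀ i, b i = mfderiv (𝓡 n) (𝓡 n) (extChartAt (𝓡 n) p).symm y
        (EuclideanSpace.single i (1 : ℝ)) := by
  have : IsManifold (𝓡 n) 1 M := IsManifold.of_le (n := ∞) (by simp)
  have h := isInvertible_mfderivWithin_extChartAt_symm (I := 𝓡 n) (x := p) hy
  rw [ModelWithCorners.range_eq_univ, mfderivWithin_univ] at h
  obtain ⟨e, he⟩ := h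
  let b₀ : Module.Basis (Fin n) ℝ (TangentSpace (𝓡 n) y) :=
    (EuclideanSpace.basisFun (Fin n) ℝ).toBasis
  refine ⟨b₀.map e.toLinearEquiv, fun i => ?_⟩
  have hb₀ : b₀ i = EuclideanSpace.single i (1 : ℝ) := by
    exact ((EuclideanSpace.basisFun (Fin n) ℝ).coe_toBasis ▸
      EuclideanSpace.basisFun_apply (Fin n) ℝ i :)
  rw [← he, Module.Basis.map_apply, hb₀]
  rfl

theorem mdifferentiableAt_extChartAt_symm (p : M) {y : EuclideanSpace ℝ (Fin n)}
    (hy : y ∈ (extChartAt (𝓡 n) p).target) :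
    MDifferentiableAt (𝓡 n) (𝓡 n) (extChartAt (𝓡 n) p).symm y := by
  have : IsManifold (𝓡 n) 1 M := IsManifold.of_le (n := ∞) (by simp)
  have h := mdifferentiableWithinAt_extChartAt_symm (I := 𝓡 n) (x := p) hy
  rwa [ModelWithCorners.range_eq_univ, mdifferentiableWithinAt_univ] at h

theorem coordPartial_comp_extChartAt_symm {u : M → ℝ} (p : M) {y : EuclideanSpace ℝ (Fin n)}
    (hy : y ∈ (extChartAt (𝓡 n) p).target)
    (hu : MDifferentiableAt (𝓡 n) 𝓘(ℝ, ℝ) u ((extChartAt (𝓡 n) p).symm y)) (i : Fin n) :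
    coordPartial i (fun z => u ((extChartAt (𝓡 n) p).symm z)) y
      = mfderiv (𝓡 n) 𝓘(ℝ, ℝ) u ((extChartAt (𝓡 n) p).symm y)
        (mfderiv (𝓡 n) (𝓡 n) (extChartAt (𝓡 n) p).symm y (EuclideanSpace.single i (1 : ℝ))) := by
  have h := mfderiv_comp y hu (mdifferentiableAt_extChartAt_symm p hy)
  rw [mfderiv_eq_fderiv] at h
  exact DFunLike.congr_fun h (EuclideanSpace.single i (1 : ℝ))

theorem contDiffOn_comp_extChartAt_symm {u : M → ℝ} (hu : ContMDiff (𝓡 n) 𝓘(ℝ, ℝ) ∞ u) (p : M) :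
    ContDiffOn ℝ ∞ (fun z => u ((extChartAt (𝓡 n) p).symm z)) (extChartAt (𝓡 n) p).target := by
  rw [← contMDiffOn_iff_contDiffOn]
  exact hu.comp_contMDiffOn (contMDiffOn_extChartAt_symm p)

/-- The differential of a real function at a point, as a linear form on the tangent space. -/
def scalarDifferential (u : M → ℝ) (q : M) : TangentSpace (𝓡 n) q →ₗ[ℝ] ℝ :=
  (mfderiv (𝓡 n) 𝓘(ℝ, ℝ) u q).toLinearMap

namespace LorentzMetric

theorem coeff_isUnit_det (g : LorentzMetric n M) (p : M) {y : EuclideanSpace ℝ (Fin n)}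
    (hy : y ∈ (extChartAt (𝓡 n) p).target) : IsUnit (g.coeff p y).det := by
  obtain ⟨b, hb⟩ := exists_coordinate_basis p hy
  have := isUnit_det_gram (g.signature _) (g.symm _) b
  simp only [hb] at this
  exact this

/-- The coefficients pair the smooth section `g` of the bundle of bilinear forms with the coordinate
vector fields, which are images of constant fields under the tangent map of the inverse chart. -/
theorem continuousOn_coeff (g : LorentzMetric n M) (p : M) :
    ContinuousOn (g.coeff p) (extChartAt (𝓡 n) p).target := by
  have hopen : IsOpen (extChartAt (𝓡 n) p).target := isOpen_extChartAt_target p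
  have hψ : ContMDiffOn (𝓡 n) (𝓡 n) ∞ (extChartAt (𝓡 n) p).symm (extChartAt (𝓡 n) p).target :=
    contMDiffOn_extChartAt_symm p
  have hT := hψ.contMDiffOn_tangentMapWithin (m := 0) (by simp) hopen.uniqueMDiffOn
  have hv : ∀ i : Fin n, ContMDiffOn (𝓡 n) (𝓡 n).tangent 0
      (fun y => Bundle.TotalSpace.mk' (EuclideanSpace ℝ (Fin n)) (E := TangentSpace (𝓡 n) (M := M))
        ((extChartAt (𝓡 n) p).symm y)
        (mfderiv (𝓡 n) (𝓡 n) (extChartAt (𝓡 n) p).symm y (EuclideanSpace.single i (1 : ℝ))))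
      (extChartAt (𝓡 n) p).target := by
    intro i
    have hc : ContMDiff (𝓡 n) (𝓡 n).tangent 0 (fun y : EuclideanSpace ℝ (Fin n) =>
        (⟨y, EuclideanSpace.single i (1 : ℝ)⟩ : TangentBundle (𝓡 n) (EuclideanSpace ℝ (Fin n)))) :=
      contMDiff_vectorSpace_iff_contDiff.2 contDiff_const
    refine (hT.comp hc.contMDiffOn (fun y hy => hy)).congr fun y hy => ?_
    simp only [Function.comp, tangentMapWithin]
    rw [mfderivWithin_of_isOpen hopen hy]
  have hg : ContMDiffOn (𝓡 n)
      ((𝓡 n).prod 𝓘(ℝ, EuclideanSpace ℝ (Fin n) →L[ℝ] EuclideanSpace ℝ (Fin n) →L[ℝ] ℝ)) 0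
      (fun y => Bundle.TotalSpace.mk'
        (EuclideanSpace ℝ (Fin n) →L[ℝ] EuclideanSpace ℝ (Fin n) →L[ℝ] ℝ)
        (E := fun x : M => TangentSpace (𝓡 n) x →L[ℝ] TangentSpace (𝓡 n) x →L[ℝ] ℝ)
        ((extChartAt (𝓡 n) p).symm y) (g.val ((extChartAt (𝓡 n) p).symm y)))
      (extChartAt (𝓡 n) p).target :=
    (g.contMDiff.of_le (by simp)).comp_contMDiffOn (hψ.of_le (by simp))
  refine continuousOn_pi.2 fun i => continuousOn_pi.2 fun j => ?_
  intro y hy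
  have h := ContMDiffWithinAt.clm_bundle_apply₂ (F₁ := EuclideanSpace ℝ (Fin n))
    (F₂ := EuclideanSpace ℝ (Fin n)) (F₃ := ℝ) (E₃ := fun _ : M => ℝ)
    (hg y hy) (hv i y hy) (hv j y hy)
  have h2 := (Bundle.contMDiffWithinAt_totalSpace.1 h).2
  exact h2.continuousWithinAt

/-- In any chart at `p` around `q`, the metric coefficients at `q` and the partial derivatives
of `u` at `q` are the components of `g` and of `du` in one basis of `T_q M`. -/
theorem exists_basis_coeff_eq (g : LorentzMetric n M) {u : M → ℝ}
    (hd : MDifferentiable (𝓡 n) 𝓘(ℝ, ℝ) u) (p : M) {q : M}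
    (hq : q ∈ (extChartAt (𝓡 n) p).source) :
    ∃ b : Module.Basis (Fin n) ℝ (TangentSpace (𝓡 n) q),
      (g.coeff p (extChartAt (𝓡 n) p q) = Matrix.of fun i j => g.val q (b i) (b j)) ∧
      ∀ i, coordPartial i (fun z => u ((extChartAt (𝓡 n) p).symm z)) (extChartAt (𝓡 n) p q)
        = scalarDifferential u q (b i) := by
  obtain ⟨y, hy, rfl⟩ : ∃ y ∈ (extChartAt (𝓡 n) p).target, (extChartAt (𝓡 n) p).symm y = q :=
    ⟨_, (extChartAt (𝓡 n) p).map_source hq, (extChartAt (𝓡 n) p).left_inv hq⟩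
  obtain ⟨b, hb⟩ := exists_coordinate_basis p hy
  rw [(extChartAt (𝓡 n) p).right_inv hy]
  refine ⟨b, ?_, fun i => ?_⟩
  · simp only [hb]; rfl
  · rw [hb, coordPartial_comp_extChartAt_symm p hy (hd _)]; rfl

/-- `gradSq u q` is defined in the preferred chart at `q`; near `p` it can be computed in the fixed
chart at `p`. -/
theorem gradSq_eq_coord (g : LorentzMetric n M) {u : M → ℝ} (hu : ContMDiff (𝓡 n) 𝓘(ℝ, ℝ) ∞ u)
    (p : M) {q : M} (hq : q ∈ (extChartAt (𝓡 n) p).source) :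
    g.gradSq u q = ∑ i, ∑ j, (g.coeff p (extChartAt (𝓡 n) p q))⁻¹ i j
      * coordPartial i (fun z => u ((extChartAt (𝓡 n) p).symm z)) (extChartAt (𝓡 n) p q)
      * coordPartial j (fun z => u ((extChartAt (𝓡 n) p).symm z)) (extChartAt (𝓡 n) p q) := by
  have hd : MDifferentiable (𝓡 n) 𝓘(ℝ, ℝ) u := hu.mdifferentiable (by simp)
  obtain ⟨b, hb, hα⟩ := g.exists_basis_coeff_eq hd p hq
  obtain ⟨b', hb', hα'⟩ := g.exists_basis_coeff_eq hd q (mem_extChartAt_source q)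
  simp only [gradSq, upper, scalarGrad, hb, hα, hb', hα']
  exact inverse_gram_contraction_eq (g.signature q) (g.symm q) b' b
    (scalarDifferential u q)

/-- By the reverse Cauchy–Schwarz inequality, `(∇u)² ≤ (du(v))²` for a unit timelike vector `v`. -/
theorem gradSq_le_sq (g : LorentzMetric n M) {u : M → ℝ} (hu : ContMDiff (𝓡 n) 𝓘(ℝ, ℝ) ∞ u)
    (p : M) {v : Fin n → ℝ} (hv : ∑ i, ∑ j, g.lower p i j * v i * v j = 1) :
    g.gradSq u p ≤ (∑ i, scalarGrad u p i * v i) ^ 2 := by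
  have hd : MDifferentiable (𝓡 n) 𝓘(ℝ, ℝ) u := hu.mdifferentiable (by simp)
  obtain ⟨b, hb, hα⟩ := g.exists_basis_coeff_eq hd p (mem_extChartAt_source p)
  have h := inverse_gram_contraction_le_sq (g.signature p) (g.symm p) b
    (scalarDifferential u p) (v := ∑ i, v i • b i) ?_
  · simp only [gradSq, upper, scalarGrad, hb, hα]
    refine h.trans_eq ?_
    congr 1
    rw [map_sum]
    refine Finset.sum_congr rfl fun i _ => ?_
    rw [map_smul, smul_eq_mul, mul_comm]
  · rw [← hv]
    simp only [lower, hb, map_sum, map_smul, Matrix.of_apply, sum_apply,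
      smul_apply, smul_eq_mul, Finset.mul_sum]
    rw [Finset.sum_comm]
    refine Finset.sum_congr rfl fun i _ => Finset.sum_congr rfl fun j _ => by ring

theorem lower_comm (g : LorentzMetric n M) (p : M) (i j : Fin n) :
    g.lower p i j = g.lower p j i :=
  g.symm _ _ _

theorem sum_upper_mul_lower (g : LorentzMetric n M) (p : M) :
    ∑ i, ∑ j, g.upper p i j * g.lower p i j = n := by
  have h := Matrix.nonsing_inv_mul _ (g.coeff_isUnit_det p (mem_extChartAt_target p))
  calc _ = ∑ i, ((g.coeff p (extChartAt (𝓡 n) p p))⁻¹ * g.coeff p (extChartAt (𝓡 n) p p)) i i := by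
        refine Finset.sum_congr rfl fun i _ => ?_
        rw [Matrix.mul_apply]
        refine Finset.sum_congr rfl fun j _ => ?_
        rw [g.lower_comm]; rfl
    _ = n := by rw [h]; simp

theorem continuousAt_gradSq (g : LorentzMetric n M) {u : M → ℝ}
    (hu : ContMDiff (𝓡 n) 𝓘(ℝ, ℝ) ∞ u) (p : M) : ContinuousAt (g.gradSq u) p := by
  have hψ : ContinuousAt (extChartAt (𝓡 n) p) p := continuousAt_extChartAt (I := 𝓡 n) p
  have ht := extChartAt_target_mem_nhds (I := 𝓡 n) p
  have hopen : IsOpen (extChartAt (𝓡 n) p).target := isOpen_extChartAt_target p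
  have hG := (g.continuousOn_coeff p).continuousAt ht
  have hGinv : ContinuousAt (fun y => (g.coeff p y)⁻¹) (extChartAt (𝓡 n) p p) := by
    simp only [Matrix.inv_def, Ring.inverse_eq_inv']
    have hdet : ContinuousAt (fun y => (g.coeff p y).det) (extChartAt (𝓡 n) p p) :=
      (Continuous.matrix_det (A := id) continuous_id).continuousAt.comp hG
    have hadj : ContinuousAt (fun y => (g.coeff p y).adjugate) (extChartAt (𝓡 n) p p) :=
      (Continuous.matrix_adjugate (A := id) continuous_id).continuousAt.comp hG
    exact (hdet.inv₀ (g.coeff_isUnit_det p (mem_extChartAt_target p)).ne_zero).smul hadj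
  have hU := contDiffOn_comp_extChartAt_symm hu p
  have hdU : ∀ i, ContinuousAt (coordPartial i (fun z => u ((extChartAt (𝓡 n) p).symm z)))
      (extChartAt (𝓡 n) p p) := fun i =>
    ((hU.continuousOn_fderiv_of_isOpen hopen (by simp)).continuousAt ht).clm_apply
      continuousAt_const
  have hev : g.gradSq u =ᶠ[nhds p] fun q => ∑ i, ∑ j, (g.coeff p (extChartAt (𝓡 n) p q))⁻¹ i j
      * coordPartial i (fun z => u ((extChartAt (𝓡 n) p).symm z)) (extChartAt (𝓡 n) p q)
      * coordPartial j (fun z => u ((extChartAt (𝓡 n) p).symm z)) (extChartAt (𝓡 n) p q) := by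
    filter_upwards [extChartAt_source_mem_nhds (I := 𝓡 n) p] with q hq
    exact g.gradSq_eq_coord hu p hq
  refine ContinuousAt.congr ?_ hev.symm
  refine tendsto_finsetSum _ fun i _ => tendsto_finsetSum _ fun j _ => ?_
  refine ContinuousAt.mul (ContinuousAt.mul ?_ ?_) ?_
  · exact (continuousAt_pi.1 (continuousAt_pi.1 (hGinv.comp hψ) i) j)
  · exact ContinuousAt.comp (hdU i) hψ
  · exact ContinuousAt.comp (hdU j) hψ

end LorentzMetric
end Chart

/-! ### Derivatives of squares and along curves -/

section Calculus

variable {n : ℕ}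

theorem contDiffAt_coordPartial {U : EuclideanSpace ℝ (Fin n) → ℝ} {y : EuclideanSpace ℝ (Fin n)}
    (hU : ContDiffAt ℝ 2 U y) (i : Fin n) : ContDiffAt ℝ 1 (coordPartial i U) y :=
  (hU.fderiv_right (m := 1) (by norm_num)).clm_apply contDiffAt_const

theorem coordPartial_mul {F H : EuclideanSpace ℝ (Fin n) → ℝ} {y : EuclideanSpace ℝ (Fin n)}
    (hF : DifferentiableAt ℝ F y) (hH : DifferentiableAt ℝ H y) (i : Fin n) :
    coordPartial i (fun z => F z * H z) y = F y * coordPartial i H y + H y * coordPartial i F y := by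
  simp [coordPartial, fderiv_fun_mul hF hH]

theorem coordPartial_sq {F : EuclideanSpace ℝ (Fin n) → ℝ} {y : EuclideanSpace ℝ (Fin n)}
    (hF : DifferentiableAt ℝ F y) (i : Fin n) :
    coordPartial i (fun z => F z ^ 2) y = 2 * (F y * coordPartial i F y) := by
  simp only [pow_two]
  rw [coordPartial_mul hF hF]; ring

theorem coordHessian_sq (G : EuclideanSpace ℝ (Fin n) → Matrix (Fin n) (Fin n) ℝ)
    {U : EuclideanSpace ℝ (Fin n) → ℝ} {y : EuclideanSpace ℝ (Fin n)}
    (hU : ContDiffAt ℝ 2 U y) (i j : Fin n) :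
    coordHessian G (fun z => U z ^ 2) i j y
      = 2 * U y * coordHessian G U i j y + 2 * coordPartial i U y * coordPartial j U y := by
  have hd : DifferentiableAt ℝ U y := hU.differentiableAt (by norm_num)
  have hev : ∀ᶠ z in nhds y, coordPartial j (fun z => U z ^ 2) z
      = 2 * (U z * coordPartial j U z) := by
    filter_upwards [hU.eventually (by simp)] with z hz
    exact coordPartial_sq (hz.differentiableAt (by norm_num)) j
  have h2 : coordPartial i (coordPartial j (fun z => U z ^ 2)) y
      = 2 * (U y * coordPartial i (coordPartial j U) y + coordPartial j U y * coordPartial i U y) := by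
    have hdj := (contDiffAt_coordPartial hU j).differentiableAt (by norm_num)
    rw [← coordPartial_mul hd hdj]
    unfold coordPartial at hev ⊢
    rw [Filter.EventuallyEq.fderiv_eq hev]
    have := fderiv_const_mul (hd.mul hdj) (2 : ℝ)
    exact DFunLike.congr_fun this _
  simp only [coordHessian, h2, coordPartial_sq hd]
  rw [mul_sub, mul_add, Finset.mul_sum]
  have : ∀ k, coordChristoffel G k i j y * (2 * (U y * coordPartial k U y))
      = 2 * U y * (coordChristoffel G k i j y * coordPartial k U y) := fun k => by ring
  simp only [this]
  ring

theorem fderiv_apply_eq_sum_coordPartial (U : EuclideanSpace ℝ (Fin n) → ℝ)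
    (y v : EuclideanSpace ℝ (Fin n)) :
    fderiv ℝ U y v = ∑ i, coordPartial i U y * v i := by
  conv_lhs => rw [← (EuclideanSpace.basisFun (Fin n) ℝ).sum_repr v]
  simp [coordPartial, mul_comm]

theorem hasDerivAt_comp_curve {U : EuclideanSpace ℝ (Fin n) → ℝ}
    {c : ℝ → EuclideanSpace ℝ (Fin n)} {τ : ℝ} (hU : DifferentiableAt ℝ U (c τ))
    (hc : DifferentiableAt ℝ c τ) :
    HasDerivAt (fun s => U (c s)) (∑ i, coordPartial i U (c τ) * deriv (fun s => c s i) τ) τ := by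
  have h := hU.hasFDerivAt.comp_hasDerivAt τ hc.hasDerivAt
  rw [fderiv_apply_eq_sum_coordPartial] at h
  have hi : ∀ i, deriv (fun s => c s i) τ = deriv c τ i := fun i =>
    ((EuclideanSpace.proj (𝕜 := ℝ) i).hasFDerivAt.comp_hasDerivAt τ hc.hasDerivAt).deriv
  simp only [hi]
  exact h

/-- The second derivative of a function along a curve, by the chain rule. -/
theorem deriv_deriv_comp_curve {U : EuclideanSpace ℝ (Fin n) → ℝ}
    {c : ℝ → EuclideanSpace ℝ (Fin n)} {τ : ℝ} (hU : ContDiffAt ℝ 2 U (c τ))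
    (hc : ContDiffAt ℝ 2 c τ) :
    deriv (deriv (fun s => U (c s))) τ
      = (∑ i, ∑ j, coordPartial i (coordPartial j U) (c τ)
          * deriv (fun s => c s i) τ * deriv (fun s => c s j) τ)
        + ∑ k, coordPartial k U (c τ) * deriv (deriv (fun s => c s k)) τ := by
  have hev : deriv (fun s => U (c s)) =ᶠ[nhds τ]
      fun s => ∑ i, coordPartial i U (c s) * deriv (fun s => c s i) s := by
    filter_upwards [hc.eventually (by simp), hc.continuousAt.eventually (hU.eventually (by simp))]
      with s hs hs'
    exact (hasDerivAt_comp_curve (hs'.differentiableAt (by norm_num))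
      (hs.differentiableAt (by norm_num))).deriv
  have hd : ∀ j, DifferentiableAt ℝ (deriv fun s => c s j) τ := by
    intro j
    have hcj : ContDiffAt ℝ 2 (fun s => c s j) τ :=
      (EuclideanSpace.proj (𝕜 := ℝ) (ι := Fin n) j).contDiff.contDiffAt.comp τ hc
    have : ContDiffAt ℝ 1 (deriv fun s => c s j) τ :=
      (hcj.fderiv_right (m := 1) (by norm_num)).clm_apply contDiffAt_const
    exact this.differentiableAt (by norm_num)
  have hsum := HasDerivAt.fun_sum (u := Finset.univ) fun j _ => (hasDerivAt_comp_curve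
    ((contDiffAt_coordPartial hU j).differentiableAt (by norm_num))
    (hc.differentiableAt (by norm_num))).mul (hd j).hasDerivAt
  rw [hev.deriv_eq]
  refine hsum.deriv.trans ?_
  rw [Finset.sum_add_distrib]
  congr 1
  rw [Finset.sum_comm]
  exact Finset.sum_congr rfl fun j _ => Finset.sum_mul ..

end Calculus

/-! ### Covariant derivatives and the contracted Einstein equation -/

section Curve

variable {n : ℕ} {M : Type*} [TopologicalSpace M]
  [ChartedSpace (EuclideanSpace ℝ (Fin n)) M] [IsManifold (𝓡 n) ∞ M]

theorem contDiffAt_comp_extChartAt_symm {u : M → ℝ} (hu : ContMDiff (𝓡 n) 𝓘(ℝ, ℝ) ∞ u) (p : M) :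
    ContDiffAt ℝ 2 (fun z => u ((extChartAt (𝓡 n) p).symm z)) (extChartAt (𝓡 n) p p) :=
  ((contDiffOn_comp_extChartAt_symm hu p).contDiffAt (extChartAt_target_mem_nhds p)).of_le
    (by norm_cast)

namespace LorentzMetric

theorem hessian_sq (g : LorentzMetric n M) {u : M → ℝ} (hu : ContMDiff (𝓡 n) 𝓘(ℝ, ℝ) ∞ u)
    (p : M) (i j : Fin n) :
    g.hessian (fun x => u x ^ 2) p i j
      = 2 * u p * g.hessian u p i j + 2 * scalarGrad u p i * scalarGrad u p j := by
  have h := coordHessian_sq (g.coeff p) (contDiffAt_comp_extChartAt_symm hu p) i j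
  simp only [extChartAt_to_inv] at h
  exact h

theorem dAlembert_sq (g : LorentzMetric n M) {u : M → ℝ} (hu : ContMDiff (𝓡 n) 𝓘(ℝ, ℝ) ∞ u)
    (p : M) :
    g.dAlembert (fun x => u x ^ 2) p = 2 * u p * g.dAlembert u p + 2 * g.gradSq u p := by
  simp only [dAlembert, gradSq, g.hessian_sq hu, Finset.mul_sum, ← Finset.sum_add_distrib]
  refine Finset.sum_congr rfl fun i _ => Finset.sum_congr rfl fun j _ => by ring

namespace IsProperTimeGeodesicOn

variable {g : LorentzMetric n M} {γ : ℝ → M} {I : Set ℝ} {u : M → ℝ} {τ : ℝ}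

theorem contMDiffAt (hγ : g.IsProperTimeGeodesicOn γ I) (hI : IsOpen I) (hτ : τ ∈ I) :
    ContMDiffAt 𝓘(ℝ, ℝ) (𝓡 n) 2 γ τ :=
  hγ.contMDiffOn.contMDiffAt (hI.mem_nhds hτ)

theorem contDiffAt_chart (hγ : g.IsProperTimeGeodesicOn γ I) (hI : IsOpen I) (hτ : τ ∈ I) :
    ContDiffAt ℝ 2 (fun s => extChartAt (𝓡 n) (γ τ) (γ s)) τ := by
  have h := (contMDiffAt_extChartAt (I := 𝓡 n) (n := ∞) (x := γ τ)).of_le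
    (m := 2) (by norm_cast)
  exact (h.comp τ (hγ.contMDiffAt hI hτ)).contDiffAt

theorem contDiffAt_comp (hγ : g.IsProperTimeGeodesicOn γ I) (hI : IsOpen I) (hτ : τ ∈ I)
    (hu : ContMDiff (𝓡 n) 𝓘(ℝ, ℝ) ∞ u) : ContDiffAt ℝ 2 (fun s => u (γ s)) τ :=
  (((hu.contMDiffAt (x := γ τ)).of_le (m := 2) (by norm_cast)).comp τ
    (hγ.contMDiffAt hI hτ)).contDiffAt

theorem comp_eventuallyEq (hγ : g.IsProperTimeGeodesicOn γ I) (hI : IsOpen I) (hτ : τ ∈ I)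
    (u : M → ℝ) : (fun s => u (γ s)) =ᶠ[nhds τ]
      fun s => u ((extChartAt (𝓡 n) (γ τ)).symm (extChartAt (𝓡 n) (γ τ) (γ s))) := by
  filter_upwards [(hγ.contMDiffAt hI hτ).continuousAt.eventually_mem
    (extChartAt_source_mem_nhds (I := 𝓡 n) (γ τ))] with s hs
  rw [(extChartAt (𝓡 n) (γ τ)).left_inv hs]

theorem deriv_comp (hγ : g.IsProperTimeGeodesicOn γ I) (hI : IsOpen I) (hτ : τ ∈ I)
    (hu : ContMDiff (𝓡 n) 𝓘(ℝ, ℝ) ∞ u) :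
    deriv (fun s => u (γ s)) τ = ∑ i : Fin n, scalarGrad u (γ τ) i * curveVelocity γ τ i := by
  rw [(hγ.comp_eventuallyEq hI hτ u).deriv_eq]
  exact (hasDerivAt_comp_curve (c := fun s => extChartAt (𝓡 n) (γ τ) (γ s))
    ((contDiffAt_comp_extChartAt_symm hu (γ τ)).differentiableAt (by norm_num))
    ((hγ.contDiffAt_chart hI hτ).differentiableAt (by norm_num))).deriv

/-- Along a geodesic the second derivative of a function is its covariant Hessian. -/
theorem deriv_deriv_comp (hγ : g.IsProperTimeGeodesicOn γ I) (hI : IsOpen I) (hτ : τ ∈ I)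
    (hu : ContMDiff (𝓡 n) 𝓘(ℝ, ℝ) ∞ u) :
    deriv (deriv fun s => u (γ s)) τ
      = ∑ i, ∑ j, g.hessian u (γ τ) i j * curveVelocity γ τ i * curveVelocity γ τ j := by
  rw [(hγ.comp_eventuallyEq hI hτ u).deriv.deriv_eq]
  refine (deriv_deriv_comp_curve (c := fun s => extChartAt (𝓡 n) (γ τ) (γ s))
    (contDiffAt_comp_extChartAt_symm hu (γ τ)) (hγ.contDiffAt_chart hI hτ)).trans ?_
  have hgeo : ∀ k, deriv (deriv (fun s => extChartAt (𝓡 n) (γ τ) (γ s) k)) τ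
      = -∑ i, ∑ j, g.christoffel (γ τ) k i j * curveVelocity γ τ i * curveVelocity γ τ j :=
    fun k => eq_neg_of_add_eq_zero_left (hγ.geodesic τ hτ k)
  simp only [hgeo, hessian, coordHessian, sub_mul, Finset.sum_sub_distrib, mul_neg,
    Finset.sum_neg_distrib, ← sub_eq_add_neg]
  congr 1
  simp only [Finset.mul_sum, Finset.sum_mul]
  rw [Finset.sum_comm]
  refine Finset.sum_congr rfl fun i _ => ?_
  rw [Finset.sum_comm]
  refine Finset.sum_congr rfl fun j _ => Finset.sum_congr rfl fun k _ => ?_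
  simp only [christoffel]
  ring

end IsProperTimeGeodesicOn

/-- The Einstein equation contracted with arbitrary components `Wⁱʲ`. -/
theorem IsEinsteinKleinGordon.contract {g : LorentzMetric n M} {m ξ : ℝ} {φ : M → ℝ}
    (h : g.IsEinsteinKleinGordon m ξ φ) (p : M) (W : Fin n → Fin n → ℝ) :
    (∑ i, ∑ j, W i j * g.ricci p i j)
        - (1 / 2) * g.ricciScalar p * ∑ i, ∑ j, W i j * g.lower p i j
      = -(8 * Real.pi * ((∑ i, ∑ j, W i j * (scalarGrad φ p i * scalarGrad φ p j))
        + (1 / 2) * (m ^ 2 * φ p ^ 2 - g.gradSq φ p) * (∑ i, ∑ j, W i j * g.lower p i j)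
        + ξ * (g.dAlembert (fun x => φ x ^ 2) p * (∑ i, ∑ j, W i j * g.lower p i j)
          - (∑ i, ∑ j, W i j * g.hessian (fun x => φ x ^ 2) p i j)
          - φ p ^ 2 * ((∑ i, ∑ j, W i j * g.ricci p i j)
            - (1 / 2) * g.ricciScalar p * ∑ i, ∑ j, W i j * g.lower p i j)))) := by
  -- contraction with `W`, as a linear functional on tensor components
  let C : (Fin n → Fin n → ℝ) →ₗ[ℝ] ℝ :=
    { toFun := fun T => ∑ i, ∑ j, W i j * T i j
      map_add' := fun S T => by simp [mul_add, Finset.sum_add_distrib]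
      map_smul' := fun a T => by
        simp only [Pi.smul_apply, smul_eq_mul, Finset.mul_sum, RingHom.id_apply]
        exact Finset.sum_congr rfl fun i _ => Finset.sum_congr rfl fun j _ => by ring }
  have hE : g.einstein p = g.ricci p - ((1 / 2) * g.ricciScalar p) • g.lower p := rfl
  have hT : g.stressEnergy m ξ φ p = (fun i j => scalarGrad φ p i * scalarGrad φ p j)
      + ((1 / 2) * (m ^ 2 * φ p ^ 2 - g.gradSq φ p)) • g.lower p
      + ξ • (g.dAlembert (fun x => φ x ^ 2) p • g.lower p - g.hessian (fun x => φ x ^ 2) p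
        - (φ p ^ 2) • g.einstein p) := by
    funext i j
    simp only [stressEnergy, Pi.add_apply, Pi.smul_apply, Pi.sub_apply, smul_eq_mul]
    ring
  have hEq : g.einstein p = -((8 * Real.pi) • g.stressEnergy m ξ φ p) :=
    funext fun i => funext fun j => h.einsteinEq p i j
  rw [hT, hE] at hEq
  have hfin := congrArg C hEq
  simp only [map_neg, map_add, map_sub, map_smul, smul_eq_mul] at hfin
  exact hfin

/-- The trace of the Einstein equation. -/
theorem IsEinsteinKleinGordon.trace {g : LorentzMetric n M} {m ξ : ℝ} {φ : M → ℝ}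
    (h : g.IsEinsteinKleinGordon m ξ φ) (p : M) :
    (1 - (n : ℝ) / 2) * g.ricciScalar p = -(8 * Real.pi * (g.gradSq φ p
      + n / 2 * (m ^ 2 * φ p ^ 2 - g.gradSq φ p)
      + ξ * ((n - 1) * g.dAlembert (fun x => φ x ^ 2) p
        - (1 - (n : ℝ) / 2) * g.ricciScalar p * φ p ^ 2))) := by
  have hW := h.contract p (g.upper p)
  simp only [← mul_assoc] at hW
  rw [g.sum_upper_mul_lower] at hW
  change g.ricciScalar p - _ = -(8 * Real.pi * (g.gradSq φ p + _
    + ξ * (_ - g.dAlembert (fun x => φ x ^ 2) p - _ * (g.ricciScalar p - _)))) at hW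
  linear_combination hW

/-- The Einstein equation contracted twice with a unit vector. -/
theorem IsEinsteinKleinGordon.contract_unit {g : LorentzMetric n M} {m ξ : ℝ} {φ : M → ℝ}
    (h : g.IsEinsteinKleinGordon m ξ φ) (p : M) {v : Fin n → ℝ}
    (hv : ∑ i, ∑ j, g.lower p i j * v i * v j = 1) :
    (∑ i, ∑ j, g.ricci p i j * v i * v j) - (1 / 2) * g.ricciScalar p
      = -(8 * Real.pi * ((∑ i, scalarGrad φ p i * v i) ^ 2
      + (1 / 2) * (m ^ 2 * φ p ^ 2 - g.gradSq φ p)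
      + ξ * (g.dAlembert (fun x => φ x ^ 2) p
        - (∑ i, ∑ j, g.hessian (fun x => φ x ^ 2) p i j * v i * v j)
        - ((∑ i, ∑ j, g.ricci p i j * v i * v j) - (1 / 2) * g.ricciScalar p) * φ p ^ 2))) := by
  have hW := h.contract p (fun i j => v i * v j)
  have hc : ∀ T : Fin n → Fin n → ℝ,
      ∑ i, ∑ j, v i * v j * T i j = ∑ i, ∑ j, T i j * v i * v j := fun T =>
    Finset.sum_congr rfl fun i _ => Finset.sum_congr rfl fun j _ => by ring
  have hα : ∑ i, ∑ j, v i * v j * (scalarGrad φ p i * scalarGrad φ p j)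
      = (∑ i, scalarGrad φ p i * v i) ^ 2 := by
    rw [pow_two, Finset.sum_mul_sum]
    exact Finset.sum_congr rfl fun i _ => Finset.sum_congr rfl fun j _ => by ring
  rw [hα, hc, hc, hc, hv] at hW
  linear_combination hW

end LorentzMetric
end Curve

/-! ### The pointwise inequality -/

section Algebra

/-- The denominator `D = (N - 2)/2 - 2(N - 1)(ξ_c - ξ) k ξ u²` that appears when
the trace of the Einstein equation is solved for the Ricci scalar. Here `N` is the dimension, `u` the
value of the field, `k` stands for `8π`, and `2(N - 1) ξ_c = (N - 2)/2`. -/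
def traceDenominator (N k ξ u : ℝ) : ℝ :=
  (N - 2) / 2 - ((N - 2) / 2 - 2 * (N - 1) * ξ) * (k * ξ * u ^ 2)

variable {N k ξ u : ℝ}

theorem two_mul_le_traceDenominator (hξc : 2 * (N - 1) * ξ ≤ (N - 2) / 2)
    (hu : k * ξ * u ^ 2 ≤ 1) : 2 * (N - 1) * ξ ≤ traceDenominator N k ξ u := by
  have := mul_nonneg (sub_nonneg.2 hξc) (sub_nonneg.2 hu)
  unfold traceDenominator
  linarith

theorem traceDenominator_pos (hN : 2 < N) (hξ : 0 ≤ ξ)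
    (hξc : 2 * (N - 1) * ξ ≤ (N - 2) / 2) (hu : k * ξ * u ^ 2 ≤ 1) :
    0 < traceDenominator N k ξ u := by
  rcases hξ.eq_or_lt with rfl | h
  · simp only [traceDenominator, mul_zero, zero_mul, sub_zero]; linarith
  · exact lt_of_lt_of_le (by have : 0 < N - 1 := by linarith
                             positivity) (two_mul_le_traceDenominator hξc hu)

/-- The contracted Einstein equation with the Ricci scalar and `□φ` eliminated by means of the trace
and of the field equation; `G` is `(∇φ)²`, `b` is `□φ`, `Q` is `□φ²`, and `v`, `s` are the first
derivative of `φ` and the second derivative of `φ²` along the curve. -/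
theorem ricci_eq_of_field_equations {m G R Q b v s Ric : ℝ} (hN : 2 < N)
    (hD : 0 < traceDenominator N k ξ u) (hw : 0 < 1 - k * ξ * u ^ 2)
    (hKG : b + m ^ 2 * u + ξ * R * u = 0) (hQ : Q = 2 * u * b + 2 * G)
    (htr : (1 - N / 2) * R = -(k * (G + N / 2 * (m ^ 2 * u ^ 2 - G)
      + ξ * ((N - 1) * Q - (1 - N / 2) * R * u ^ 2))))
    (hRic : Ric - (1 / 2) * R = -(k * (v ^ 2 + (1 / 2) * (m ^ 2 * u ^ 2 - G)
      + ξ * (Q - s - (Ric - (1 / 2) * R) * u ^ 2)))) :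
    Ric = k / (1 - k * ξ * u ^ 2) * (-v ^ 2 + ξ * s + (m ^ 2 * u ^ 2
      + ξ * (((N - 2) * G - m ^ 2 * u ^ 2 * (N - 2 + 2 * (k * ξ * u ^ 2)))
        / traceDenominator N k ξ u)) / (N - 2)) := by
  have hN' : N - 2 ≠ 0 := by linarith
  have hb : b = -(m ^ 2 * u + ξ * R * u) := by linarith
  have hQ' : Q = 2 * G - 2 * m ^ 2 * u ^ 2 - 2 * ξ * R * u ^ 2 := by rw [hQ, hb]; ring
  have hDR : traceDenominator N k ξ u * R
      = k * (-((N - 2) / 2 - 2 * (N - 1) * ξ) * G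
        + (1 + ((N - 2) / 2 - 2 * (N - 1) * ξ)) * (m ^ 2 * u ^ 2)) := by
    rw [hQ'] at htr
    unfold traceDenominator
    linear_combination -htr
  have hDQ : ((N - 2) * G - m ^ 2 * u ^ 2 * (N - 2 + 2 * (k * ξ * u ^ 2)))
      / traceDenominator N k ξ u = Q := by
    rw [div_eq_iff hD.ne', hQ']
    have : (2 * G - 2 * m ^ 2 * u ^ 2 - 2 * ξ * R * u ^ 2) * traceDenominator N k ξ u
      = (2 * G - 2 * m ^ 2 * u ^ 2) * traceDenominator N k ξ u
        - 2 * ξ * u ^ 2 * (traceDenominator N k ξ u * R) := by ring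
    rw [this, hDR]
    unfold traceDenominator
    ring
  rw [hDQ, div_mul_eq_mul_div, eq_div_iff hw.ne']
  have key : (N - 2) * (Ric * (1 - k * ξ * u ^ 2))
      = k * ((N - 2) * (-v ^ 2 + ξ * s) + (m ^ 2 * u ^ 2 + ξ * Q)) := by
    linear_combination (N - 2) * hRic - htr
  apply mul_left_cancel₀ hN'
  rw [key]
  field_simp

/-- The pointwise form of the inequality: after the term `k ξ (h² (φ²)')'` has been split off,
the remainder is a sum of nonnegative terms, among them `2ξ (h v + h' u)²`. -/
theorem ricci_mul_sq_le {m G v s Ric f h h' : ℝ} (hN : 2 < N) (hk : 0 ≤ k) (hξ : 0 ≤ ξ)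
    (hξc : 2 * (N - 1) * ξ ≤ (N - 2) / 2) (hw : 0 < 1 - k * ξ * u ^ 2) (hG : G ≤ v ^ 2)
    (hh : h ^ 2 = f ^ 2 / (1 - k * ξ * u ^ 2))
    (hRic : Ric = k / (1 - k * ξ * u ^ 2) * (-v ^ 2 + ξ * s + (m ^ 2 * u ^ 2
      + ξ * (((N - 2) * G - m ^ 2 * u ^ 2 * (N - 2 + 2 * (k * ξ * u ^ 2)))
        / traceDenominator N k ξ u)) / (N - 2))) :
    Ric * f ^ 2 ≤ ((1 - 2 * ξ) / (N - 2) * (m ^ 2 * f ^ 2 / (1 - k * ξ * u ^ 2))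
        + 2 * ξ * h' ^ 2) * (k * u ^ 2)
      + k * ξ * (2 * h * h' * (2 * u * v) + h ^ 2 * s) := by
  have hN2 : 0 < N - 2 := by linarith
  have hN1 : 0 < N - 1 := by linarith
  have hu : k * ξ * u ^ 2 ≤ 1 := by linarith
  have hD := traceDenominator_pos hN hξ hξc hu
  have hD' := two_mul_le_traceDenominator hξc hu
  set D := traceDenominator N k ξ u with hDdef
  have ha : 0 ≤ (N - 2) / 2 - 2 * (N - 1) * ξ := sub_nonneg.2 hξc
  have hx : 0 ≤ k * ξ * u ^ 2 := by positivity
  have hbox : ((N - 2) * G - m ^ 2 * u ^ 2 * (N - 2 + 2 * (k * ξ * u ^ 2))) / D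
      ≤ (N - 2) * (v ^ 2 / D) - 2 * m ^ 2 * u ^ 2 := by
    have h1 : (N - 2) * (v ^ 2 / D) - 2 * m ^ 2 * u ^ 2
        = ((N - 2) * v ^ 2 - 2 * m ^ 2 * u ^ 2 * D) / D := by field_simp
    rw [h1]
    gcongr ?_ / D
    have h2 : 2 * D ≤ N - 2 + 2 * (k * ξ * u ^ 2) := by
      have := mul_nonneg ha hx
      rw [hDdef, traceDenominator]
      linarith
    have h3 := mul_le_mul_of_nonneg_left h2 (by positivity : 0 ≤ m ^ 2 * u ^ 2)
    have h4 := mul_le_mul_of_nonneg_left hG hN2.le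
    linarith
  -- the bound on `ξ` by the conformal value `ξ_c` leaves a nonnegative coefficient of `h² v²`
  have he : ξ / D + 2 * ξ ≤ 1 := by
    have h1 : ξ / D ≤ 1 / (2 * (N - 1)) := by
      rw [div_le_div_iff₀ hD (by positivity)]; linarith
    have h2 : 2 * ξ ≤ 1 - 1 / (2 * (N - 1)) := by
      have : 1 - 1 / (2 * (N - 1)) = (2 * (N - 1) - 1) / (2 * (N - 1)) := by field_simp
      rw [this, le_div_iff₀ (by positivity)]
      linarith
    linarith
  have hmass : m ^ 2 * f ^ 2 / (1 - k * ξ * u ^ 2) = m ^ 2 * h ^ 2 := by rw [hh]; ring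
  have hL : Ric * f ^ 2 = k * h ^ 2 * (-v ^ 2 + ξ * s + (m ^ 2 * u ^ 2
      + ξ * (((N - 2) * G - m ^ 2 * u ^ 2 * (N - 2 + 2 * (k * ξ * u ^ 2))) / D)) / (N - 2)) := by
    rw [hRic, hh]; ring
  rw [hL, hmass]
  have hup : k * h ^ 2 * (-v ^ 2 + ξ * s + (m ^ 2 * u ^ 2
      + ξ * (((N - 2) * G - m ^ 2 * u ^ 2 * (N - 2 + 2 * (k * ξ * u ^ 2))) / D)) / (N - 2))
      ≤ k * h ^ 2 * (-v ^ 2 + ξ * s + (m ^ 2 * u ^ 2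
      + ξ * ((N - 2) * (v ^ 2 / D) - 2 * m ^ 2 * u ^ 2)) / (N - 2)) := by
    gcongr
  refine hup.trans ?_
  rw [← sub_nonneg]
  have : ((1 - 2 * ξ) / (N - 2) * (m ^ 2 * h ^ 2) + 2 * ξ * h' ^ 2) * (k * u ^ 2)
      + k * ξ * (2 * h * h' * (2 * u * v) + h ^ 2 * s)
      - k * h ^ 2 * (-v ^ 2 + ξ * s + (m ^ 2 * u ^ 2
      + ξ * ((N - 2) * (v ^ 2 / D) - 2 * m ^ 2 * u ^ 2)) / (N - 2))
      = k * (h ^ 2 * v ^ 2 * (1 - (ξ / D + 2 * ξ)) + 2 * ξ * (h * v + h' * u) ^ 2) := by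
    field_simp
    ring
  rw [this]
  have := sub_nonneg.2 he
  positivity

end Algebra

/-! ### Functions supported in the support of `f` -/

section Support

theorem contDiffAt_deriv {F : ℝ → ℝ} {τ : ℝ} {m k : WithTop ℕ∞} (hF : ContDiffAt ℝ k F τ)
    (hmk : m + 1 ≤ k) : ContDiffAt ℝ m (deriv F) τ :=
  (hF.fderiv_right hmk).clm_apply contDiffAt_const

theorem continuous_of_continuousAt_tsupport {f F : ℝ → ℝ} (h0 : ∀ τ ∉ tsupport f, F τ = 0)
    (h : ∀ τ ∈ tsupport f, ContinuousAt F τ) : Continuous F := by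
  rw [continuous_iff_continuousAt]
  intro τ
  by_cases hτ : τ ∈ tsupport f
  · exact h τ hτ
  · refine continuousAt_const (y := (0 : ℝ)) |>.congr ?_
    filter_upwards [(isClosed_tsupport f).isOpen_compl.mem_nhds hτ] with s hs
    exact (h0 s hs).symm

theorem integrable_of_continuousAt_tsupport {f F : ℝ → ℝ} (hf : HasCompactSupport f)
    (h0 : ∀ τ ∉ tsupport f, F τ = 0) (h : ∀ τ ∈ tsupport f, ContinuousAt F τ) :
    MeasureTheory.Integrable F :=
  (continuous_of_continuousAt_tsupport h0 h).integrable_of_hasCompactSupport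
    (HasCompactSupport.intro hf h0)

theorem setIntegral_eq_integral_of_tsupport_subset {f F : ℝ → ℝ} {I : Set ℝ}
    (hI : tsupport f ⊆ I) (h0 : ∀ τ ∉ tsupport f, F τ = 0) : ∫ τ in I, F τ = ∫ τ, F τ :=
  MeasureTheory.setIntegral_eq_integral_of_forall_compl_eq_zero fun τ hτ =>
    h0 τ fun h => hτ (hI h)

/-- The derivative of a function that is `C¹` near the support of `f` and vanishes off it has
integral zero. -/
theorem integral_deriv_eq_zero_of_tsupport {f B : ℝ → ℝ} (hf : HasCompactSupport f)
    (h0 : ∀ τ ∉ tsupport f, B τ = 0) (h : ∀ τ ∈ tsupport f, ContDiffAt ℝ 1 B τ) :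
    MeasureTheory.Integrable (deriv B) ∧ ∫ τ, deriv B τ = 0 := by
  have hB : ContDiff ℝ 1 B := by
    rw [contDiff_iff_contDiffAt]
    intro τ
    by_cases hτ : τ ∈ tsupport f
    · exact h τ hτ
    · refine (contDiffAt_const (c := (0 : ℝ))).congr_of_eventuallyEq ?_
      filter_upwards [(isClosed_tsupport f).isOpen_compl.mem_nhds hτ] with s hs
      exact h0 s hs
  have hc : HasCompactSupport B := HasCompactSupport.intro hf h0
  have hi : MeasureTheory.Integrable (deriv B) :=
    (hB.continuous_deriv le_rfl).integrable_of_hasCompactSupport hc.deriv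
  exact ⟨hi, MeasureTheory.integral_eq_zero_of_hasDerivAt_of_integrable
    (fun τ => (hB.differentiable (by norm_num) τ).hasDerivAt) hi
    (hB.continuous.integrable_of_hasCompactSupport hc)⟩

end Support

/-! ### The Ricci curvature along a geodesic -/

section Geodesic

variable {n : ℕ} {M : Type*} [TopologicalSpace M]
  [ChartedSpace (EuclideanSpace ℝ (Fin n)) M] [IsManifold (𝓡 n) ∞ M]

namespace LorentzMetric.IsProperTimeGeodesicOn

variable {g : LorentzMetric n M} {γ : ℝ → M} {I : Set ℝ} {τ : ℝ}

/-- The Ricci curvature along the geodesic in terms of the field. The only geometric quantity on the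
right, `(∇φ)²`, is invariant under changes of chart, whereas `ricciAlong` refers to a chart that moves
with the base point. -/
theorem ricciAlong_eq (hγ : g.IsProperTimeGeodesicOn γ I) (hI : IsOpen I) (hτ : τ ∈ I)
    (hn : 2 < n) {m ξ : ℝ} {φ : M → ℝ} (hsol : g.IsEinsteinKleinGordon m ξ φ) (hξ : 0 ≤ ξ)
    (hξc : 2 * ((n : ℝ) - 1) * ξ ≤ ((n : ℝ) - 2) / 2)
    (hw : 0 < 1 - 8 * Real.pi * ξ * φ (γ τ) ^ 2) :
    g.ricciAlong γ τ = 8 * Real.pi / (1 - 8 * Real.pi * ξ * φ (γ τ) ^ 2)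
      * (-(deriv (fun s => φ (γ s)) τ) ^ 2 + ξ * deriv (deriv fun s => φ (γ s) ^ 2) τ
        + (m ^ 2 * φ (γ τ) ^ 2 + ξ * ((((n : ℝ) - 2) * g.gradSq φ (γ τ)
          - m ^ 2 * φ (γ τ) ^ 2 * ((n : ℝ) - 2 + 2 * (8 * Real.pi * ξ * φ (γ τ) ^ 2)))
          / traceDenominator n (8 * Real.pi) ξ (φ (γ τ)))) / ((n : ℝ) - 2)) := by
  have hφ := hsol.contMDiff
  have hφ2 : ContMDiff (𝓡 n) 𝓘(ℝ, ℝ) ∞ fun x => φ x ^ 2 := hφ.pow 2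
  have hN : (2 : ℝ) < n := by exact_mod_cast hn
  have hc := hsol.contract_unit (γ τ) (hγ.unit τ hτ)
  rw [← hγ.deriv_comp hI hτ hφ, ← hγ.deriv_deriv_comp hI hτ hφ2] at hc
  exact ricci_eq_of_field_equations hN (traceDenominator_pos hN hξ hξc (by linarith)) hw
    (hsol.kleinGordon (γ τ)) (g.dAlembert_sq hφ (γ τ)) (hsol.trace (γ τ)) hc

/-- Continuity is read off from `ricciAlong_eq`, which makes the transformation law of the Ricci
tensor unnecessary. -/
theorem continuousAt_ricciAlong (hγ : g.IsProperTimeGeodesicOn γ I) (hI : IsOpen I) (hτ : τ ∈ I)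
    (hn : 2 < n) {m ξ : ℝ} {φ : M → ℝ} (hsol : g.IsEinsteinKleinGordon m ξ φ) (hξ : 0 ≤ ξ)
    (hξc : 2 * ((n : ℝ) - 1) * ξ ≤ ((n : ℝ) - 2) / 2)
    (hw : 0 < 1 - 8 * Real.pi * ξ * φ (γ τ) ^ 2) :
    ContinuousAt (g.ricciAlong γ) τ := by
  have hN : (2 : ℝ) < n := by exact_mod_cast hn
  have hu := hγ.contDiffAt_comp hI hτ hsol.contMDiff
  have huc := hu.continuousAt
  have hu'c := (contDiffAt_deriv (m := 1) hu (by norm_num)).continuousAt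
  have hu2c := (contDiffAt_deriv (m := 0)
    (contDiffAt_deriv (m := 1) (hu.pow 2) (by norm_num)) (by norm_num)).continuousAt
  have hwc : ContinuousAt (fun s => 1 - 8 * Real.pi * ξ * φ (γ s) ^ 2) τ :=
    continuousAt_const.sub (continuousAt_const.mul (huc.pow 2))
  have hGc : ContinuousAt (fun s => g.gradSq φ (γ s)) τ :=
    (g.continuousAt_gradSq hsol.contMDiff (γ τ)).comp (hγ.contMDiffAt hI hτ).continuousAt
  have hDc : ContinuousAt (fun s => traceDenominator n (8 * Real.pi) ξ (φ (γ s))) τ :=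
    continuousAt_const.sub (continuousAt_const.mul (continuousAt_const.mul (huc.pow 2)))
  have hD := traceDenominator_pos (k := 8 * Real.pi) (u := φ (γ τ)) hN hξ hξc (by linarith)
  have hev : ∀ᶠ s in nhds τ, s ∈ I ∧ 0 < 1 - 8 * Real.pi * ξ * φ (γ s) ^ 2 :=
    (hI.eventually_mem hτ).and (hwc.eventually_const_lt hw)
  refine ContinuousAt.congr ?_ (hev.mono fun s hs =>
    (hγ.ricciAlong_eq hI hs.1 hn hsol hξ hξc hs.2).symm)
  refine ContinuousAt.mul (continuousAt_const.div hwc hw.ne') ?_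
  refine ((hu'c.pow 2).neg.add (continuousAt_const.mul hu2c)).add (ContinuousAt.div_const ?_ _)
  refine (continuousAt_const.mul (huc.pow 2)).add
    (continuousAt_const.mul (ContinuousAt.div ?_ hDc hD.ne'))
  exact (continuousAt_const.mul hGc).sub ((continuousAt_const.mul (huc.pow 2)).mul
    (continuousAt_const.add (continuousAt_const.mul (continuousAt_const.mul (huc.pow 2)))))

end LorentzMetric.IsProperTimeGeodesicOn

end Geodesic

end

theorem theorem3 {n : ℕ} (hn : 2 < n) {M : Type*} [TopologicalSpace M]
    [ChartedSpace (EuclideanSpace ℝ (Fin n)) M] [IsManifold (𝓡 n) ∞ M]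
    (g : LorentzMetric n M) (m ξ : ℝ) (φ : M → ℝ)
    (hsol : g.IsEinsteinKleinGordon m ξ φ)
    (hξ0 : 0 ≤ ξ) (hξc : ξ ≤ ((n : ℝ) - 2) / (4 * ((n : ℝ) - 1)))
    (hφ : ∀ x, 8 * Real.pi * ξ * φ x ^ 2 ≤ 1)
    (I : Set ℝ) (hIo : IsOpen I) (hIc : I.OrdConnected)
    (γ : ℝ → M) (hγ : g.IsProperTimeGeodesicOn γ I)
    (f : ℝ → ℝ) (hf : ContDiff ℝ 2 f) (hfc : HasCompactSupport f) (hfI : tsupport f ⊆ I)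
    (hφf : ∀ τ ∈ tsupport f, 8 * Real.pi * ξ * φ (γ τ) ^ 2 < 1) :
    MeasureTheory.IntegrableOn (fun τ => g.ricciAlong γ τ * f τ ^ 2) I ∧
    MeasureTheory.IntegrableOn (fun τ =>
      ((1 - 2 * ξ) / ((n : ℝ) - 2) * (m ^ 2 * f τ ^ 2 / (1 - 8 * Real.pi * ξ * φ (γ τ) ^ 2))
        + 2 * ξ * (deriv (fun s => f s / √(1 - 8 * Real.pi * ξ * φ (γ s) ^ 2)) τ) ^ 2)
      * (8 * Real.pi * φ (γ τ) ^ 2)) I ∧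
    ∫ τ in I, g.ricciAlong γ τ * f τ ^ 2 ≤
      ∫ τ in I,
        ((1 - 2 * ξ) / ((n : ℝ) - 2) * (m ^ 2 * f τ ^ 2 / (1 - 8 * Real.pi * ξ * φ (γ τ) ^ 2))
          + 2 * ξ * (deriv (fun s => f s / √(1 - 8 * Real.pi * ξ * φ (γ s) ^ 2)) τ) ^ 2)
        * (8 * Real.pi * φ (γ τ) ^ 2) := by
  have hN : (2 : ℝ) < n := by exact_mod_cast hn
  have hξc' : 2 * ((n : ℝ) - 1) * ξ ≤ ((n : ℝ) - 2) / 2 := by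
    rw [le_div_iff₀ (by linarith)] at hξc
    linarith
  set h : ℝ → ℝ := fun s => f s / √(1 - 8 * Real.pi * ξ * φ (γ s) ^ 2) with hh
  have hf0 : ∀ τ ∉ tsupport f, f τ = 0 := fun τ hτ => image_eq_zero_of_notMem_tsupport hτ
  have hw : ∀ τ ∈ tsupport f, 0 < 1 - 8 * Real.pi * ξ * φ (γ τ) ^ 2 := fun τ hτ =>
    sub_pos.2 (hφf τ hτ)
  have hu : ∀ τ ∈ tsupport f, ContDiffAt ℝ 2 (fun s => φ (γ s)) τ := fun τ hτ =>
    hγ.contDiffAt_comp hIo (hfI hτ) hsol.contMDiff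
  have hwd : ∀ τ ∈ tsupport f, ContDiffAt ℝ 2 (fun s => 1 - 8 * Real.pi * ξ * φ (γ s) ^ 2) τ :=
    fun τ hτ => contDiffAt_const.sub (contDiffAt_const.mul ((hu τ hτ).pow 2))
  have hhd : ∀ τ ∈ tsupport f, ContDiffAt ℝ 2 h τ := fun τ hτ =>
    hf.contDiffAt.div ((hwd τ hτ).sqrt (hw τ hτ).ne') (Real.sqrt_pos.2 (hw τ hτ)).ne'
  have hu2d : ∀ τ ∈ tsupport f, ContDiffAt ℝ 1 (deriv fun s => φ (γ s) ^ 2) τ :=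
    fun τ hτ => contDiffAt_deriv (m := 1) ((hu τ hτ).pow 2) (by norm_num)
  have hh0 : ∀ τ ∉ tsupport f, deriv h τ = 0 := by
    intro τ hτ
    have : h =ᶠ[nhds τ] fun _ => 0 := by
      filter_upwards [(isClosed_tsupport f).isOpen_compl.mem_nhds hτ] with s hs
      simp [hh, hf0 s hs]
    rw [this.deriv_eq, deriv_const]
  -- `ξ h² (φ²)''` equals `ξ B' - 4 ξ h h' φ φ'`, and `B'` integrates to zero
  set B : ℝ → ℝ := fun s => h s ^ 2 * deriv (fun s => φ (γ s) ^ 2) s with hB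
  have hB0 : ∀ τ ∉ tsupport f, B τ = 0 := fun τ hτ => by simp [hB, hh, hf0 τ hτ]
  obtain ⟨hBint, hBzero⟩ := integral_deriv_eq_zero_of_tsupport hfc hB0 fun τ hτ =>
    (((hhd τ hτ).of_le (by norm_num)).pow 2).mul (hu2d τ hτ)
  have hBd : ∀ τ ∈ tsupport f, deriv B τ = 2 * h τ * deriv h τ
      * (2 * φ (γ τ) * deriv (fun s => φ (γ s)) τ)
      + h τ ^ 2 * deriv (deriv fun s => φ (γ s) ^ 2) τ := by
    intro τ hτ
    have h1 := ((hhd τ hτ).differentiableAt (by norm_num)).hasDerivAt.pow 2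
    have h2 := ((hu2d τ hτ).differentiableAt (by norm_num)).hasDerivAt
    have h3 := ((hu τ hτ).differentiableAt (by norm_num)).hasDerivAt.pow 2
    have h4 : deriv (fun s => φ (γ s) ^ 2) τ = 2 * φ (γ τ) * deriv (fun s => φ (γ s)) τ :=
      h3.deriv.trans (by norm_num)
    refine (h1.mul h2).deriv.trans ?_
    rw [h4]
    simp
  set F₁ : ℝ → ℝ := fun τ => g.ricciAlong γ τ * f τ ^ 2 with hF₁
  set F₂ : ℝ → ℝ := fun τ =>
      ((1 - 2 * ξ) / ((n : ℝ) - 2) * (m ^ 2 * f τ ^ 2 / (1 - 8 * Real.pi * ξ * φ (γ τ) ^ 2))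
        + 2 * ξ * (deriv h τ) ^ 2) * (8 * Real.pi * φ (γ τ) ^ 2) with hF₂
  have h10 : ∀ τ ∉ tsupport f, F₁ τ = 0 := fun τ hτ => by simp [hF₁, hf0 τ hτ]
  have h20 : ∀ τ ∉ tsupport f, F₂ τ = 0 := fun τ hτ => by simp [hF₂, hf0 τ hτ, hh0 τ hτ]
  have h1c : ∀ τ ∈ tsupport f, ContinuousAt F₁ τ := fun τ hτ =>
    (hγ.continuousAt_ricciAlong hIo (hfI hτ) hn hsol hξ0 hξc' (hw τ hτ)).mul
      (hf.continuous.continuousAt.pow 2)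
  have h2c : ∀ τ ∈ tsupport f, ContinuousAt F₂ τ := by
    intro τ hτ
    have hwc := (hwd τ hτ).continuousAt
    have huc := (hu τ hτ).continuousAt
    have hfc' := hf.continuous.continuousAt (x := τ)
    have hh'c := (contDiffAt_deriv (m := 1) (hhd τ hτ) (by norm_num)).continuousAt
    have hdiv := (continuousAt_const (y := m ^ 2)).mul (hfc'.pow 2) |>.div hwc (hw τ hτ).ne'
    exact ((continuousAt_const.mul hdiv).add (continuousAt_const.mul (hh'c.pow 2))).mul
      (continuousAt_const.mul (huc.pow 2))
  have h1i := integrable_of_continuousAt_tsupport hfc h10 h1c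
  have h2i := integrable_of_continuousAt_tsupport hfc h20 h2c
  refine ⟨h1i.integrableOn, h2i.integrableOn, ?_⟩
  -- all integrands vanish off the support of `f`, so the integrals may be taken over `ℝ`
  rw [setIntegral_eq_integral_of_tsupport_subset hfI h10,
    setIntegral_eq_integral_of_tsupport_subset hfI h20]
  have hle : ∀ τ, F₁ τ ≤ F₂ τ + 8 * Real.pi * ξ * deriv B τ := by
    intro τ
    by_cases hτ : τ ∈ tsupport f
    · rw [hBd τ hτ]
      refine ricci_mul_sq_le hN (by positivity) hξ0 hξc' (hw τ hτ) (G := g.gradSq φ (γ τ)) ?_ ?_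
        (hγ.ricciAlong_eq hIo (hfI hτ) hn hsol hξ0 hξc' (hw τ hτ))
      · rw [hγ.deriv_comp hIo (hfI hτ) hsol.contMDiff]
        exact g.gradSq_le_sq hsol.contMDiff (γ τ) (hγ.unit τ (hfI hτ))
      · rw [hh, div_pow, Real.sq_sqrt (hw τ hτ).le]
    · have : deriv B τ = 0 := by
        have : B =ᶠ[nhds τ] fun _ => 0 := by
          filter_upwards [(isClosed_tsupport f).isOpen_compl.mem_nhds hτ] with s hs
          exact hB0 s hs
        rw [this.deriv_eq, deriv_const]
      rw [h10 τ hτ, h20 τ hτ, this]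
      simp
  calc ∫ τ, F₁ τ ≤ ∫ τ, (F₂ τ + 8 * Real.pi * ξ * deriv B τ) :=
        MeasureTheory.integral_mono h1i (h2i.add (hBint.const_mul _)) hle
    _ = ∫ τ, F₂ τ := by
        rw [MeasureTheory.integral_add h2i (hBint.const_mul _),
          MeasureTheory.integral_const_mul, hBzero, mul_zero, add_zero]
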